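/- **Minimum input theorem.** Consider structural descriptor systems $F\dot x = Ax + Bu$ with $n$ equations, $n$ states and $m$ inputs, given by the zero/nonzero patterns of $F, A$ ($n\times n$) and $B$ ($n\times m$). Such a system is *structurally controllable* if $\operatorname{rank}[A - zF \mid B] = n$ for all $z\in\mathbb{C}$ whenever $F, A, B$ are real matrices with these patterns that are generic, i.e. whose nonzero entries, all taken together, are algebraically independent over $\mathbb{Q}$. For a pattern $P$ let $G_P$ be the bipartite graph between columns and rows in which column $j$ and row $i$ are joined if and only if $P_{ij}\neq 0$; let $G_{A-sF}$ be the graph whose edges are those of $G_A$ together with those of $G_F$; and let $\nu(G)$ be the maximum size of a matching of $G$. Suppose that $\nu(G_{A-sF}) = n$ (that is, the system is solvable). Then the minimum number $m \ge 1$ of inputs for which some $n\times m$ pattern $B$ makes the system structurally controllable is $$n_D = \max\{\,n - \nu(G_A),\ 1\,\}.$$ Moreover, such an optimal $B$ can be computed in polynomial time: there are a program of a random access machine (whose arithmetic operations, of unit cost, are addition, truncated subtraction and comparison) and a polynomial $p$ such that, for every $n$ and all patterns $F, A$ with $\nu(G_{A-sF}) = n$, the program, on input $(n, F, A)$, halts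 after at most $p(n)$ steps and puts out $n_D$ and an $n\times n_D$ pattern $B$ for which the system is structurally controllable. -/

import Mathlib

namespace Descriptor

/-! ### Bipartite graphs and matchings -/

section Matching

variable {α β : Type*}

/-- `M` is a matching of the bipartite graph on `α ⊔ β` with edge set `E`: a set of edges
no two of which share an end. -/
def IsMatching (E M : Finset (α × β)) : Prop :=
  M ⊆ E ∧ ∀ e ∈ M, ∀ f ∈ M, e ≠ f → e.1 ≠ f.1 ∧ e.2 ≠ f.2

open Classical in
/-- The maximum size `ν` of a matching of the bipartite graph with edge set `E`. -/
noncomputable def matchingNumber (E : Finset (α × β)) : ℕ :=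
  (E.powerset.filter (IsMatching E)).sup Finset.card

end Matching

/-! ### Zero/nonzero patterns and generic matrices -/

/-- A zero/nonzero pattern of an `n × m` matrix: `true` marks the free nonzero entries. -/
abbrev Pattern (n m : ℕ) := Matrix (Fin n) (Fin m) Bool

/-- The edge set of the bipartite graph of a pattern: the column node `x_j` and the row node `e_i`
are joined if and only if the entry `(i, j)` is nonzero. -/
def Pattern.edges {n m : ℕ} (P : Pattern n m) : Finset (Fin m × Fin n) :=
  Finset.univ.filter fun e => P e.2 e.1 = true

/-- The real matrix `M` has the zero/nonzero pattern `P`. -/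
def HasPattern {n m : ℕ} (M : Matrix (Fin n) (Fin m) ℝ) (P : Pattern n m) : Prop :=
  ∀ i j, M i j ≠ 0 ↔ P i j = true

/-- All the entries of the three matrices `F`, `A`, `B`, as one family. -/
def entries {n m : ℕ} (F A : Matrix (Fin n) (Fin n) ℝ) (B : Matrix (Fin n) (Fin m) ℝ) :
    (Fin n × Fin n) ⊕ (Fin n × Fin n) ⊕ (Fin n × Fin m) → ℝ :=
  Sum.elim (fun e => F e.1 e.2) (Sum.elim (fun e => A e.1 e.2) (fun e => B e.1 e.2))

/-- `F`, `A`, `B` are generic: their nonzero entries, all taken together, are algebraically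
independent over `ℚ`. -/
def IsGeneric {n m : ℕ} (F A : Matrix (Fin n) (Fin n) ℝ) (B : Matrix (Fin n) (Fin m) ℝ) : Prop :=
  AlgebraicIndependent ℚ (fun e : {e // entries F A B e ≠ 0} => entries F A B e.1)

/-- Every choice of patterns is realized by generic real matrices. -/
theorem exists_generic {n m : ℕ} (F A : Pattern n n) (B : Pattern n m) :
    ∃ F' A' B', HasPattern F' F ∧ HasPattern A' A ∧ HasPattern B' B ∧ IsGeneric F' A' B' := by
  obtain ⟨s, hs⟩ := exists_isTranscendenceBasis ℚ ℝ
  have hinf : Infinite s := by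
    by_contra hfin
    rw [not_infinite_iff_finite] at hfin
    have hc : Countable (Algebra.adjoin ℚ (Set.range ((↑) : s → ℝ))) :=
      hs.1.aevalEquiv.toEquiv.countable_iff.mp (by
        rw [← Cardinal.mk_le_aleph0_iff]
        exact MvPolynomial.cardinalMk_le_max.trans (by simp [Cardinal.mk_le_aleph0]))
    have := hs.isAlgebraic
    have h1 := Algebra.IsAlgebraic.cardinalMk_le_max
      (Algebra.adjoin ℚ (Set.range ((↑) : s → ℝ))) ℝ
    rw [max_eq_right (Cardinal.mk_le_aleph0_iff.mpr hc), Cardinal.mk_real] at h1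
    exact absurd h1 (not_le.mpr Cardinal.aleph0_lt_continuum)
  have hne : ∀ x : s, (x : ℝ) ≠ 0 := fun x => hs.1.ne_zero x
  let ι := (Fin n × Fin n) ⊕ (Fin n × Fin n) ⊕ (Fin n × Fin m)
  obtain ⟨g⟩ : Nonempty (ι ↪ s) := by
    obtain ⟨e⟩ := Finite.exists_equiv_fin ι |>.choose_spec
    exact ⟨e.toEmbedding.trans (Fin.valEmbedding.trans (Infinite.natEmbedding s))⟩
  refine ⟨fun i j => if F i j then g (.inl (i, j)) else 0,
    fun i j => if A i j then g (.inr (.inl (i, j))) else 0,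
    fun i j => if B i j then g (.inr (.inr (i, j))) else 0, ?_, ?_, ?_, ?_⟩
  · intro i j; simp [hne]
  · intro i j; simp [hne]
  · intro i j; simp [hne]
  · have key := hs.1.comp (fun e : {e : ι // entries (fun i j => if F i j then (g (.inl (i, j)) : ℝ) else 0)
      (fun i j => if A i j then (g (.inr (.inl (i, j))) : ℝ) else 0)
      (fun i j => if B i j then (g (.inr (.inr (i, j))) : ℝ) else 0) e ≠ 0} => g e.1)
      (g.injective.comp Subtype.val_injective)
    unfold IsGeneric
    convert key using 1
    funext e
    revert e
    rintro ⟨e | e | e, he⟩ <;>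
      simp only [entries, Sum.elim_inl, Sum.elim_inr, Function.comp] at he ⊢ <;>
      split_ifs at he ⊢ <;> simp_all

/-! ### Structural controllability -/

/-- The modal controllability matrix `[A - zF | B]` at `z ∈ ℂ`. -/
noncomputable def modalMatrix {n m : ℕ} (F A : Matrix (Fin n) (Fin n) ℝ)
    (B : Matrix (Fin n) (Fin m) ℝ) (z : ℂ) : Matrix (Fin n) (Fin n ⊕ Fin m) ℂ :=
  Matrix.fromCols (A.map Complex.ofReal - z • F.map Complex.ofReal) (B.map Complex.ofReal)

/-- The structural descriptor system `F x' = A x + B u` is structurally controllable: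
`rank [A - zF | B] = n` for all `z ∈ ℂ`, for generic matrices of the given patterns. -/
def StructurallyControllable {n m : ℕ} (F A : Pattern n n) (B : Pattern n m) : Prop :=
  ∀ (F' A' : Matrix (Fin n) (Fin n) ℝ) (B' : Matrix (Fin n) (Fin m) ℝ),
    HasPattern F' F → HasPattern A' A → HasPattern B' B → IsGeneric F' A' B' →
      ∀ z : ℂ, (modalMatrix F' A' B' z).rank = n

/-- The numbers `m ≥ 1` of inputs for which some `n × m` pattern `B` makes the system
structurally controllable. -/
def feasibleInputCounts {n : ℕ} (F A : Pattern n n) : Set ℕ :=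
  {m | 1 ≤ m ∧ ∃ B : Pattern n m, StructurallyControllable F A B}

/-! ### A random access machine with a step count

Programs act on a memory made of arrays of natural numbers, with two indices. The arithmetic
operations are addition, truncated subtraction and comparison; there is no multiplication, so in
`t` steps the bit length of the stored numbers grows by `O(t)` at most, and polynomial time means
the same as for Turing machines. -/

/-- A memory: `σ a i j` is the content of the cell `(i, j)` of the array number `a`. -/
abbrev Store := ℕ → ℕ → ℕ → ℕ

/-- Write `v` into the cell `(i, j)` of the array `a`. -/
def Store.write (σ : Store) (a i j v : ℕ) : Store :=
  fun a' i' j' => if a' = a ∧ i' = i ∧ j' = j then v else σ a' i' j'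

/-- Arithmetic expressions; `cell a e f` reads the array `a` at the values of `e` and `f`. -/
inductive Expr where
  | lit (k : ℕ)
  | cell (a : ℕ) (e f : Expr)
  | add (e f : Expr)
  | sub (e f : Expr)
  | lt (e f : Expr)

/-- The value of an expression (`lt` gives `1` for true and `0` for false). -/
def Expr.eval (σ : Store) : Expr → ℕ
  | .lit k => k
  | .cell a e f => σ a (e.eval σ) (f.eval σ)
  | .add e f => e.eval σ + f.eval σ
  | .sub e f => e.eval σ - f.eval σ
  | .lt e f => if e.eval σ < f.eval σ then 1 else 0

/-- The number of elementary operations needed to evaluate an expression. -/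
def Expr.cost : Expr → ℕ
  | .lit _ => 1
  | .cell _ e f => e.cost + f.cost + 1
  | .add e f => e.cost + f.cost + 1
  | .sub e f => e.cost + f.cost + 1
  | .lt e f => e.cost + f.cost + 1

/-- Programs: do nothing, write the value of `v` into the cell `(e, f)` of the array `a`, run
two programs in turn, branch on whether an expression is nonzero, and repeat while an expression
is nonzero. -/
inductive Program where
  | skip
  | assign (a : ℕ) (e f v : Expr)
  | seq (P Q : Program)
  | branch (c : Expr) (P Q : Program)
  | loop (c : Expr) (P : Program)

/-- `Runs P σ τ t`: the program `P`, started on the memory `σ`, halts with the memory `τ` after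
exactly `t` steps. -/
inductive Runs : Program → Store → Store → ℕ → Prop where
  | skip (σ : Store) : Runs .skip σ σ 1
  | assign (a : ℕ) (e f v : Expr) (σ : Store) :
      Runs (.assign a e f v) σ (σ.write a (e.eval σ) (f.eval σ) (v.eval σ))
        (e.cost + f.cost + v.cost + 1)
  | seq {P Q : Program} {σ τ ρ : Store} {s t : ℕ} :
      Runs P σ τ s → Runs Q τ ρ t → Runs (.seq P Q) σ ρ (s + t)
  | branch_true {c : Expr} {P Q : Program} {σ τ : Store} {t : ℕ} :
      c.eval σ ≠ 0 → Runs P σ τ t → Runs (.branch c P Q) σ τ (c.cost + t + 1)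
  | branch_false {c : Expr} {P Q : Program} {σ τ : Store} {t : ℕ} :
      c.eval σ = 0 → Runs Q σ τ t → Runs (.branch c P Q) σ τ (c.cost + t + 1)
  | loop_done {c : Expr} {P : Program} {σ : Store} :
      c.eval σ = 0 → Runs (.loop c P) σ σ (c.cost + 1)
  | loop_step {c : Expr} {P : Program} {σ τ ρ : Store} {s t : ℕ} :
      c.eval σ ≠ 0 → Runs P σ τ s → Runs (.loop c P) τ ρ t →
        Runs (.loop c P) σ ρ (c.cost + s + t + 1)

/-- Programs are deterministic: the final memory and the step count are unique. -/
theorem Runs.det {P : Program} {σ τ τ' : Store} {t t' : ℕ} (h : Runs P σ τ t)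
    (h' : Runs P σ τ' t') : τ = τ' ∧ t = t' := by
  induction h generalizing τ' t' with
  | skip => cases h'; simp
  | assign => cases h'; simp
  | seq _ _ i1 i2 =>
    cases h' with | seq a b => obtain ⟨rfl, rfl⟩ := i1 a; obtain ⟨rfl, rfl⟩ := i2 b; simp
  | branch_true hc _ i => cases h' with
    | branch_true _ a => obtain ⟨rfl, rfl⟩ := i a; simp
    | branch_false h _ => exact absurd h hc
  | branch_false hc _ i => cases h' with
    | branch_false _ a => obtain ⟨rfl, rfl⟩ := i a; simp
    | branch_true h _ => exact absurd hc h
  | loop_done hc => cases h' with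
    | loop_done => simp
    | loop_step h _ _ => exact absurd hc h
  | loop_step hc _ _ i1 i2 => cases h' with
    | loop_done h => exact absurd h hc
    | loop_step _ a b => obtain ⟨rfl, rfl⟩ := i1 a; obtain ⟨rfl, rfl⟩ := i2 b; simp

/-- A pattern as an array of zeros and ones. -/
def Pattern.toArray {n m : ℕ} (P : Pattern n m) (i j : ℕ) : ℕ :=
  if h : i < n ∧ j < m then (if P ⟨i, h.1⟩ ⟨j, h.2⟩ = true then 1 else 0) else 0

/-- The initial memory for the input `(n, F, A)`: `n` is in the cell `(0, 0)` of the array `0`,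
`F` in the array `1`, `A` in the array `2`, and everything else is zero. -/
def inputStore {n : ℕ} (F A : Pattern n n) : Store := fun a i j =>
  if a = 0 then (if i = 0 ∧ j = 0 then n else 0)
  else if a = 1 then F.toArray i j
  else if a = 2 then A.toArray i j
  else 0

/-- The number of inputs that a halted program has put out: the cell `(0, 0)` of the array `3`. -/
def outputCount (σ : Store) : ℕ := σ 3 0 0

/-- The `n × m` pattern that a halted program has put out: the nonzero cells of the array `4`. -/
def outputPattern (n m : ℕ) (σ : Store) : Pattern n m :=
  fun i j => decide (σ 4 i j ≠ 0)

end Descriptor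

/-!
The lower bound is the case `z = 0`: if `[A | B]` has rank `n`, some nonzero `n × n` minor has a
nonzero term, and this term contains a matching of `A` that misses at most `m` rows
(`le_matchingNumber_add_of_rank_eq`).

For the upper bound, the input pattern `B` with all entries free already works
(`structurallyControllable_full`). A determinant whose entries are polynomials in algebraically
independent numbers is nonzero if it is nonzero for some values of these numbers
(`det_ne_zero_of_specializes`). So it is enough to choose `n` columns of `[A - zF | B]` into which
the rows can be matched, and to turn these columns into the identity matrix.
* For `z = 0` a maximum matching of `A` is extended by columns of `B`.
* If `z ≠ 0` is algebraic over `ℚ`, the entries are algebraically independent over the field of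
  algebraic numbers, and a perfect matching of `A - zF` serves.
* If `z` is transcendental, it can be exchanged for one entry: `z` and the other entries are
  algebraically independent over `ℚ` (`exists_algebraicIndependent_option`). This entry is avoided
  by leaving out its column, in the place of which a column of `B` is taken if need be.

It remains to compute `ν(A)` in polynomial time, which is done by an auction. Rows without a column
bid for a neighbour of the least price, which drives out the former owner and raises the price by
one, until every row owns a column or sees only neighbours with the price `n + 2`. As the total
price grows with each bid, `n (n + 3)` sweeps over the rows suffice. In the end the owned columns
are those of a maximum matching (`AuctionState.Valid.matchingNumber_eq`). The program consists of
nested `for` loops, and its correctness and running time are obtained from Hoare triples with a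
time bound.
-/

namespace Descriptor

/-! ### Specialization of generic matrices -/

section Specialization

open MvPolynomial

/-- The number `c ∈ E` and the value `s ∈ k` are values of one and the same polynomial over `k`,
at the points `y` and `v`: informally, `c` turns into `s` when `y` is replaced by `v`. -/
def Specializes {k E τ : Type*} [Field k] [Field E] [Algebra k E] (y : τ → E) (v : τ → k)
    (c : E) (s : k) : Prop :=
  ∃ p : MvPolynomial τ k, aeval y p = c ∧ eval v p = s

variable {k E τ : Type*} [Field k] [Field E] [Algebra k E] {y : τ → E} {v : τ → k}

theorem Specializes.var (e : τ) : Specializes y v (y e) (v e) := ⟨X e, by simp, by simp⟩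

theorem Specializes.algebraMap (a : k) : Specializes y v (algebraMap k E a) a :=
  ⟨C a, by simp, by simp⟩

theorem Specializes.zero : Specializes y v 0 0 := ⟨0, by simp, by simp⟩

theorem Specializes.sub {c c' : E} {s s' : k} (h : Specializes y v c s)
    (h' : Specializes y v c' s') : Specializes y v (c - c') (s - s') := by
  obtain ⟨p, rfl, rfl⟩ := h
  obtain ⟨q, rfl, rfl⟩ := h'
  exact ⟨p - q, by simp, by simp⟩

theorem Specializes.mul {c c' : E} {s s' : k} (h : Specializes y v c s)
    (h' : Specializes y v c' s') : Specializes y v (c * c') (s * s') := by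
  obtain ⟨p, rfl, rfl⟩ := h
  obtain ⟨q, rfl, rfl⟩ := h'
  exact ⟨p * q, by simp, by simp⟩

/-- A determinant is nonzero at an algebraically independent point as soon as it is nonzero at some
point. -/
theorem det_ne_zero_of_specializes {n : Type*} [Fintype n] [DecidableEq n]
    (hy : AlgebraicIndependent k y) {N : Matrix n n E} {S : Matrix n n k}
    (h : ∀ i j, Specializes y v (N i j) (S i j)) (hS : S.det ≠ 0) : N.det ≠ 0 := by
  choose p hp hpS using h
  have hN : N = (aeval y).mapMatrix (Matrix.of p) := by ext i j; simp [hp]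
  have hS' : S = (eval v).mapMatrix (Matrix.of p) := by ext i j; simp [hpS]
  rw [hN, ← AlgHom.map_det]
  rw [hS', ← RingHom.map_det] at hS
  intro h0
  rw [(injective_iff_map_eq_zero _).1 hy _ h0] at hS
  simp at hS

end Specialization

/-- Exchange: in an algebraically independent family, some member can be replaced by a given
transcendental element. -/
theorem exists_algebraicIndependent_option {k E τ : Type*} [Field k] [Field E] [Algebra k E]
    [Nonempty τ] {x : τ → E} (hx : AlgebraicIndependent k x) {z : E} (hz : Transcendental k z) :
    ∃ e, AlgebraicIndependent k
      (fun o : Option {e' // e' ≠ e} => o.elim z fun e' => x e'.1) := by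
  by_contra! hcon
  let M := AlgebraicIndependent.matroid k E
  have hI : M.Indep (Set.range x) := AlgebraicIndependent.matroid_indep_iff.2 hx.to_subtype_range
  have hmem : z ∈ ⋂ e, M.closure (Set.range fun e' : {e' // e' ≠ e} => x e'.1) := by
    refine Set.mem_iInter.2 fun e => ?_
    by_contra hze
    refine hcon e (((hx.comp _ Subtype.val_injective).option_iff_transcendental z).2 fun hal => ?_)
    rw [AlgebraicIndependent.matroid_closure_eq] at hze
    exact hze hal
  rw [← hI.closure_iInter_eq_biInter_closure_of_forall_subset
    (fun e => by rintro _ ⟨e', rfl⟩; exact ⟨_, rfl⟩)] at hmem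
  have hempty : (⋂ e, Set.range fun e' : {e' // e' ≠ e} => x e'.1) = ∅ := by
    refine Set.eq_empty_of_forall_notMem fun c hc => ?_
    obtain ⟨e⟩ : Nonempty τ := inferInstance
    rw [Set.mem_iInter] at hc
    obtain ⟨⟨e', _⟩, he'⟩ := hc e
    obtain ⟨⟨e'', he''⟩, h⟩ := hc e'
    exact he'' (hx.injective (h.trans he'.symm))
  rw [hempty, AlgebraicIndependent.matroid_closure_eq] at hmem
  have hal : IsAlgebraic (Algebra.adjoin k (∅ : Set E)) z := hmem
  rw [Algebra.adjoin_empty] at hal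
  exact hz (Subalgebra.isAlgebraic_of_isAlgebraic_bot hal)

/-! ### Generic full row rank of `[A - zF | B]` -/

section Rank

variable {n m : ℕ}

/-- The column of `[A - zF | B]` in which an entry of `F`, `A` or `B` stands. -/
def entryColumn : (Fin n × Fin n) ⊕ (Fin n × Fin n) ⊕ (Fin n × Fin m) → Fin n ⊕ Fin m :=
  Sum.elim (fun e => .inl e.2) (Sum.elim (fun e => .inl e.2) fun e => .inr e.2)

open Classical in
/-- Values of the entries of `F`, `A`, `B` for which the columns `g 0, …, g (n - 1)` of
`[A - zF | B]` form the identity matrix. The entry in row `i` and column `g i` comes from `A` where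
the pattern of `A` allows it, and from `F` otherwise, where the value `-z⁻¹` makes up for the factor
`-z`. -/
noncomputable def identityEntries {k : Type*} [Field k] (A : Pattern n n)
    (g : Fin n → Fin n ⊕ Fin m) (z : k) :
    (Fin n × Fin n) ⊕ (Fin n × Fin n) ⊕ (Fin n × Fin m) → k :=
  Sum.elim (fun e => if g e.1 = .inl e.2 ∧ A e.1 e.2 = false then -z⁻¹ else 0)
    (Sum.elim (fun e => if g e.1 = .inl e.2 ∧ A e.1 e.2 = true then 1 else 0)
      (fun e => if g e.1 = .inr e.2 then 1 else 0))

theorem identityEntries_eq_zero {k : Type*} [Field k] {F A : Pattern n n} {B : Pattern n m}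
    {F' A' : Matrix (Fin n) (Fin n) ℝ} {B' : Matrix (Fin n) (Fin m) ℝ}
    (hF : HasPattern F' F) (hA : HasPattern A' A) (hB : HasPattern B' B)
    {g : Fin n → Fin n ⊕ Fin m} (z : k)
    (hgA : ∀ i j, g i = .inl j → A i j = true ∨ F i j = true)
    (hgB : ∀ i j, g i = .inr j → B i j = true)
    {e : (Fin n × Fin n) ⊕ (Fin n × Fin n) ⊕ (Fin n × Fin m)} (he : entries F' A' B' e = 0) :
    identityEntries A g z e = 0 := by
  obtain ⟨i, j⟩ | ⟨i, j⟩ | ⟨i, j⟩ := e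
  · refine if_neg fun h => (hF i j).2 ?_ he
    simpa [h.2] using hgA i j h.1
  · exact if_neg fun h => (hA i j).2 h.2 he
  · exact if_neg fun h => (hB i j).2 (hgB i j h) he

theorem rank_eq_of_det_submatrix_ne_zero {ι : Type*} [Fintype ι] {M : Matrix (Fin n) ι ℂ}
    {g : Fin n → ι} (h : (M.submatrix id g).det ≠ 0) : M.rank = n := by
  refine le_antisymm (M.rank_le_card_height.trans_eq (Fintype.card_fin n)) ?_
  calc n = (M.submatrix id g).rank := by
        rw [Matrix.rank_of_isUnit _ ((Matrix.isUnit_iff_isUnit_det _).2 h.isUnit), Fintype.card_fin]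
    _ ≤ M.rank := M.rank_submatrix_le id g

/-- If the rows of `[A - zF | B]` are matched into its columns by `g`, and the entries in the
columns used by `g` specialize to `identityEntries`, then the matrix has full row rank. -/
theorem rank_modalMatrix_of_specializes {k τ : Type*} [Field k] [Algebra k ℂ] {y : τ → ℂ}
    (hy : AlgebraicIndependent k y) (v : τ → k) {z : ℂ} {z' : k} (hz : Specializes y v z z')
    {A : Pattern n n} {F' A' : Matrix (Fin n) (Fin n) ℝ} {B' : Matrix (Fin n) (Fin m) ℝ}
    {g : Fin n → Fin n ⊕ Fin m} (hg : Function.Injective g)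
    (hgA : ∀ i j, g i = .inl j → A i j = true ∨ z' ≠ 0)
    (hs : ∀ e, entryColumn e ∈ Set.range g →
      Specializes y v (entries F' A' B' e : ℂ) (identityEntries A g z' e)) :
    (modalMatrix F' A' B' z).rank = n := by
  classical
  refine rank_eq_of_det_submatrix_ne_zero (g := g)
    (det_ne_zero_of_specializes (v := v) (S := 1) hy (fun i i' => ?_) (by simp))
  have hii : (g i = g i') ↔ i = i' := hg.eq_iff
  rcases hgi : g i' with j | j
  · have h1 := hs (.inl (i, j)) ⟨i', hgi⟩
    have h2 := hs (.inr (.inl (i, j))) ⟨i', hgi⟩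
    have h3 := h2.sub (hz.mul h1)
    convert h3 using 1
    · simp [modalMatrix, hgi, entries]
    · simp only [identityEntries, Sum.elim_inl, Sum.elim_inr, Matrix.one_apply, ← hii, hgi]
      by_cases hij : g i = .inl j
      · rcases hgA i j hij with h | h
        · simp [hij, h]
        · cases hA : A i j <;> simp [hij, h]
      · simp [hij]
  · convert hs (.inr (.inr (i, j))) ⟨i', hgi⟩ using 1
    · simp [modalMatrix, hgi, entries]
    · simp [identityEntries, Matrix.one_apply, ← hii, hgi]

end Rank

section Sufficiency

variable {n m : ℕ} {F A : Pattern n n} {B : Pattern n m}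
  {F' A' : Matrix (Fin n) (Fin n) ℝ} {B' : Matrix (Fin n) (Fin m) ℝ}

theorem IsGeneric.complex (h : IsGeneric F' A' B') :
    AlgebraicIndependent ℚ (fun e : {e // entries F' A' B' e ≠ 0} => (entries F' A' B' e.1 : ℂ)) :=
  h.map' (f := IsScalarTower.toAlgHom ℚ ℝ ℂ) Complex.ofReal_injective

/-- At `z` algebraic over `ℚ`, the matrix `[A - zF | B]` has full generic row rank if its rows can be
matched into its columns: the entries are algebraically independent over the field of all algebraic
numbers, too. -/
theorem rank_modalMatrix_of_isAlgebraic (hF : HasPattern F' F) (hA : HasPattern A' A)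
    (hB : HasPattern B' B) (hgen : IsGeneric F' A' B') {z : ℂ} (hz : IsAlgebraic ℚ z)
    {g : Fin n → Fin n ⊕ Fin m} (hg : Function.Injective g)
    (hgA : ∀ i j, g i = .inl j → A i j = true ∨ (F i j = true ∧ z ≠ 0))
    (hgB : ∀ i j, g i = .inr j → B i j = true) :
    (modalMatrix F' A' B' z).rank = n := by
  let z' : algebraicClosure ℚ ℂ := ⟨z, mem_algebraicClosure_iff.2 hz⟩
  refine rank_modalMatrix_of_specializes (k := algebraicClosure ℚ ℂ) (A := A)
    hgen.complex.algebraicClosure (fun e => identityEntries A g z' e.1) (z' := z')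
    (.algebraMap z') hg (fun i j h => ?_) fun e _ => ?_
  · refine (hgA i j h).imp_right fun h0 h1 => h0.2 ?_
    simpa [z'] using congrArg Subtype.val h1
  · by_cases he : entries F' A' B' e = 0
    · rw [identityEntries_eq_zero hF hA hB z' (fun i j h => (hgA i j h).imp_right And.left) hgB he,
        he, Complex.ofReal_zero]
      exact .zero
    · exact .var (v := fun e : {e // entries F' A' B' e ≠ 0} => identityEntries A g z' e.1) ⟨e, he⟩

/-- At `z` transcendental over `ℚ` the matrix `[A - zF | B]` has full generic row rank if `A - zF`
has full term rank and the first column of `B` is full. The number `z` can be exchanged for one of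
the entries, and the column of that entry is then avoided with the help of the column of `B`. -/
theorem rank_modalMatrix_of_transcendental (hF : HasPattern F' F) (hA : HasPattern A' A)
    (hB : HasPattern B' B) (hgen : IsGeneric F' A' B') {z : ℂ} (hz : Transcendental ℚ z)
    {π : Fin n → Fin n} (hπ : Function.Injective π)
    (hπA : ∀ i, A i (π i) = true ∨ F i (π i) = true) (hm : 0 < m)
    (hB0 : ∀ i, B i ⟨0, hm⟩ = true) :
    (modalMatrix F' A' B' z).rank = n := by
  rcases n.eq_zero_or_pos with rfl | hn
  · exact Nat.le_zero.1 ((Matrix.rank_le_card_height _).trans_eq (Fintype.card_fin 0))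
  have : Nonempty {e // entries F' A' B' e ≠ 0} :=
    ⟨⟨.inr (.inr (⟨0, hn⟩, ⟨0, hm⟩)), (hB _ _).2 (hB0 _)⟩⟩
  obtain ⟨e₀, he₀⟩ := exists_algebraicIndependent_option hgen.complex hz
  obtain ⟨g, hg, hgA, hgB, hcol⟩ : ∃ g : Fin n → Fin n ⊕ Fin m, Function.Injective g ∧
      (∀ i j, g i = .inl j → A i j = true ∨ F i j = true) ∧
      (∀ i j, g i = .inr j → B i j = true) ∧ entryColumn e₀.1 ∉ Set.range g := by
    -- A column of `A - zF` is replaced by the first column of `B`; one of `B` is not used by `π`.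
    rcases entryColumn e₀.1 with c | c
    · refine ⟨fun i => if π i = c then .inr ⟨0, hm⟩ else .inl (π i), fun i i' h => ?_,
        fun i j h => ?_, fun i j h => ?_, ?_⟩
      · dsimp only at h
        split_ifs at h with h1 h2 h2
        · exact hπ (h1.trans h2.symm)
        · exact hπ (Sum.inl_injective h)
      · dsimp only at h
        split_ifs at h
        exact Sum.inl_injective h ▸ hπA i
      · dsimp only at h
        split_ifs at h
        exact Sum.inr_injective h ▸ hB0 i
      · rintro ⟨i, h⟩
        dsimp only at h
        split_ifs at h with h1
        exact h1 (Sum.inl_injective h)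
    · exact ⟨fun i => .inl (π i), fun i i' h => hπ (Sum.inl_injective h),
        fun i j h => Sum.inl_injective h ▸ hπA i, by simp, by simp⟩
  let v : Option {e' // e' ≠ e₀} → ℚ := fun o => o.elim 1 fun e => identityEntries A g 1 e.1.1
  refine rank_modalMatrix_of_specializes (A := A) he₀ v (z' := 1) (.var none) hg
    (fun i j _ => .inr one_ne_zero) fun e he => ?_
  by_cases he0 : entries F' A' B' e = 0
  · rw [identityEntries_eq_zero hF hA hB 1 hgA hgB he0, he0, Complex.ofReal_zero]
    exact .zero
  · have hne : (⟨e, he0⟩ : {e // entries F' A' B' e ≠ 0}) ≠ e₀ := by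
      rintro rfl
      exact hcol he
    exact .var (v := v) (some ⟨⟨e, he0⟩, hne⟩)

end Sufficiency

/-! ### Matchings and the minimum number of inputs -/

section Matchings

variable {n m : ℕ}

theorem IsMatching.card_le_matchingNumber {α β : Type*} {E M : Finset (α × β)}
    (h : IsMatching E M) : M.card ≤ matchingNumber E := by
  classical
  exact Finset.le_sup (f := Finset.card)
    (Finset.mem_filter.2 ⟨Finset.mem_powerset.2 h.1, h⟩)

theorem exists_isMatching_card_eq {α β : Type*} (E : Finset (α × β)) :
    ∃ M, IsMatching E M ∧ M.card = matchingNumber E := by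
  classical
  have hne : (E.powerset.filter (IsMatching E)).Nonempty :=
    ⟨∅, Finset.mem_filter.2 ⟨Finset.mem_powerset.2 (Finset.empty_subset _), by simp [IsMatching]⟩⟩
  obtain ⟨M, hM, h⟩ := Finset.exists_mem_eq_sup _ hne Finset.card
  exact ⟨M, (Finset.mem_filter.1 hM).2, h.symm⟩

theorem IsMatching.fst_injOn {α β : Type*} {E M : Finset (α × β)} (h : IsMatching E M) :
    Set.InjOn Prod.fst (M : Set (α × β)) := fun e he f hf hef => by
  by_contra hne
  exact (h.2 e he f hf hne).1 hef

theorem IsMatching.snd_injOn {α β : Type*} {E M : Finset (α × β)} (h : IsMatching E M) :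
    Set.InjOn Prod.snd (M : Set (α × β)) := fun e he f hf hef => by
  by_contra hne
  exact (h.2 e he f hf hne).2 hef

/-- A matching that misses at most `m` rows extends to an injection of all rows into the columns
and `m` further ones. -/
theorem IsMatching.exists_injective {E M : Finset (Fin n × Fin n)} (h : IsMatching E M)
    (hc : n ≤ M.card + m) :
    ∃ g : Fin n → Fin n ⊕ Fin m, Function.Injective g ∧ ∀ i j, g i = .inl j → (j, i) ∈ E := by
  classical
  have hR : (M.image Prod.snd).card = M.card := Finset.card_image_of_injOn h.snd_injOn
  have hcard : Fintype.card {i // i ∉ M.image Prod.snd} ≤ Fintype.card (Fin m) := by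
    rw [Fintype.card_subtype_compl, Fintype.card_fin, Fintype.card_fin, Fintype.card_coe, hR]
    omega
  obtain ⟨f⟩ := Function.Embedding.nonempty_of_card_le hcard
  have hex : ∀ i : {i // i ∈ M.image Prod.snd}, ∃ j, (j, i.1) ∈ M := fun i => by
    obtain ⟨⟨j, i'⟩, he, hi⟩ := Finset.mem_image.1 i.2
    exact ⟨j, by rw [← hi]; exact he⟩
  choose c hcM using hex
  refine ⟨fun i => if hi : i ∈ M.image Prod.snd then .inl (c ⟨i, hi⟩) else .inr (f ⟨i, hi⟩),
    fun i i' hii => ?_, fun i j hij => ?_⟩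
  · dsimp only at hii
    split_ifs at hii with h1 h2 h2
    · have := h.fst_injOn (hcM ⟨i, h1⟩) (hcM ⟨i', h2⟩) (Sum.inl_injective hii)
      exact congrArg Prod.snd this
    · exact congrArg Subtype.val (f.injective (Sum.inr_injective hii))
  · dsimp only at hij
    split_ifs at hij with h1
    exact h.1 (Sum.inl_injective hij ▸ hcM ⟨i, h1⟩)

/-- Full row rank of `[A | B]` forces a matching of `A` that misses at most `m` rows: a nonzero
maximal minor has a nonzero term in its Leibniz expansion. -/
theorem le_matchingNumber_add_of_rank_eq {F' A' : Matrix (Fin n) (Fin n) ℝ}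
    {B' : Matrix (Fin n) (Fin m) ℝ} {A : Pattern n n} (hA : HasPattern A' A)
    (h : (modalMatrix F' A' B' 0).rank = n) : n ≤ matchingNumber A.edges + m := by
  classical
  set M := modalMatrix F' A' B' 0
  obtain ⟨κ, a, ha, hspan, hli⟩ := exists_linearIndependent' ℂ M.col
  have : Fintype κ := Fintype.ofInjective a ha
  have hcard : Fintype.card κ = n := by
    rw [← h, Matrix.rank_eq_finrank_span_cols, ← hspan, finrank_span_eq_card hli]
  let φ := (Fintype.equivFinOfCardEq hcard).symm
  have hli' : LinearIndependent ℂ (M.submatrix id (a ∘ φ)).col := hli.comp φ φ.injective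
  have hdet : (M.submatrix id (a ∘ φ)).det ≠ 0 :=
    ((Matrix.isUnit_iff_isUnit_det _).1 (Matrix.linearIndependent_cols_iff_isUnit.1 hli')).ne_zero
  rw [Matrix.det_apply] at hdet
  obtain ⟨σ, -, hσ⟩ := Finset.exists_ne_zero_of_sum_ne_zero hdet
  have hσ' : ∀ i, M (σ i) (a (φ i)) ≠ 0 := fun i h0 =>
    hσ (by rw [Finset.prod_eq_zero (Finset.mem_univ i) (by simpa using h0), smul_zero])
  have hinj : Function.Injective (a ∘ φ) := ha.comp φ.injective
  let T : Finset (Fin n × Fin n) :=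
    Finset.univ.filter fun e => a (φ (σ.symm e.2)) = .inl e.1
  have hT : IsMatching A.edges T := by
    refine ⟨fun e he => ?_, fun e he f hf hne => ?_⟩
    · have he : a (φ (σ.symm e.2)) = .inl e.1 := (Finset.mem_filter.1 he).2
      have h0 := hσ' (σ.symm e.2)
      rw [he, σ.apply_symm_apply] at h0
      simp only [Pattern.edges, Finset.mem_filter, Finset.mem_univ, true_and]
      refine (hA _ _).1 fun h1 => h0 ?_
      simp [M, modalMatrix, h1]
    · have he : a (φ (σ.symm e.2)) = .inl e.1 := (Finset.mem_filter.1 he).2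
      have hf : a (φ (σ.symm f.2)) = .inl f.1 := (Finset.mem_filter.1 hf).2
      refine ⟨fun h1 => hne ?_, fun h2 => hne ?_⟩
      · refine Prod.ext h1 (σ.symm.injective (hinj ?_))
        simp [he, hf, h1]
      · refine Prod.ext (Sum.inl_injective (β := Fin m) ?_) h2
        rw [← he, ← hf, h2]
  refine le_trans ?_ (Nat.add_le_add_right hT.card_le_matchingNumber m)
  have hmap : Function.Injective fun i : Fin n =>
      (a (φ (σ.symm i))) := hinj.comp σ.symm.injective
  have hsub : (Finset.univ.image fun i : Fin n => a (φ (σ.symm i))) ⊆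
      T.image (fun e => Sum.inl e.1) ∪ Finset.univ.image Sum.inr := by
    intro c hc
    obtain ⟨i, -, rfl⟩ := Finset.mem_image.1 hc
    rcases hi : a (φ (σ.symm i)) with j | j
    · exact Finset.mem_union_left _ (Finset.mem_image.2
        ⟨(j, i), Finset.mem_filter.2 ⟨Finset.mem_univ _, hi⟩, rfl⟩)
    · exact Finset.mem_union_right _ (Finset.mem_image.2 ⟨j, Finset.mem_univ _, rfl⟩)
  calc n = (Finset.univ.image fun i : Fin n => a (φ (σ.symm i))).card := by
        rw [Finset.card_image_of_injective _ hmap, Finset.card_univ, Fintype.card_fin]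
    _ ≤ _ := Finset.card_le_card hsub
    _ ≤ _ := Finset.card_union_le _ _
    _ ≤ T.card + m := Nat.add_le_add Finset.card_image_le
        (Finset.card_image_le.trans (by simp))

end Matchings

section MinimumInput

variable {n m : ℕ} {F A : Pattern n n}

/-- For a solvable system, the full input pattern with `m ≥ 1` inputs makes the system structurally
controllable as soon as `m ≥ n - ν(A)`. -/
theorem structurallyControllable_full (hsolv : matchingNumber (A.edges ∪ F.edges) = n)
    (hm : 1 ≤ m) (hmn : n - matchingNumber A.edges ≤ m) :
    StructurallyControllable F A (fun _ _ => true : Pattern n m) := by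
  intro F' A' B' hF hA hB hgen z
  obtain ⟨N, hN, hNc⟩ := exists_isMatching_card_eq (A.edges ∪ F.edges)
  obtain ⟨g, hg, hgE⟩ := hN.exists_injective (m := 0) (by omega)
  have hex : ∀ i, ∃ j, g i = .inl j := fun i => by
    rcases hgi : g i with j | j
    · exact ⟨j, rfl⟩
    · exact j.elim0
  choose π hπ using hex
  have hπinj : Function.Injective π := fun i i' h => hg (by rw [hπ, hπ, h])
  have hπE : ∀ i, A i (π i) = true ∨ F i (π i) = true := fun i => by
    simpa [Pattern.edges] using hgE i (π i) (hπ i)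
  by_cases hz : IsAlgebraic ℚ z
  · by_cases hz0 : z = 0
    · obtain ⟨N, hN, hNc⟩ := exists_isMatching_card_eq A.edges
      obtain ⟨g, hg, hgE⟩ := hN.exists_injective (m := m) (by omega)
      refine rank_modalMatrix_of_isAlgebraic hF hA hB hgen hz hg
        (fun i j h => .inl ?_) fun _ _ _ => rfl
      simpa [Pattern.edges] using hgE i j h
    · refine rank_modalMatrix_of_isAlgebraic hF hA hB hgen hz (g := fun i => .inl (π i))
        (fun i i' h => hπinj (Sum.inl_injective h)) (fun i j h => ?_) fun _ _ _ => rfl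
      rw [← Sum.inl_injective h]
      exact (hπE i).imp_right fun h => ⟨h, hz0⟩
  · exact rank_modalMatrix_of_transcendental hF hA hB hgen hz hπinj hπE hm fun _ => rfl

theorem isLeast_feasibleInputCounts (hsolv : matchingNumber (A.edges ∪ F.edges) = n) :
    IsLeast (feasibleInputCounts F A) (max (n - matchingNumber A.edges) 1) := by
  refine ⟨⟨le_max_right _ _, _, structurallyControllable_full hsolv (le_max_right _ _)
    (le_max_left _ _)⟩, ?_⟩
  rintro m ⟨hm, B, hB⟩
  obtain ⟨F', A', B', hF', hA', hB', hgen⟩ := exists_generic F A B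
  have := le_matchingNumber_add_of_rank_eq hA' (hB F' A' B' hF' hA' hB' hgen 0)
  omega

end MinimumInput

/-! ### The auction algorithm for bipartite matchings -/

section Auction

/-- A state of the auction. Each row bids for a column, and a new bid drives out the old one:
`owner j` is `i + 1` if the row `i` made the last bid for the column `j`, and `0` if there was no
bid; `target i` is the column for which the row `i` made its last bid; `price j` is the number of
bids for the column `j`. -/
structure AuctionState where
  owner : ℕ → ℕ
  target : ℕ → ℕ
  price : ℕ → ℕ

namespace AuctionState

/-- The row `i` owns the column for which it made its last bid. -/
def Owns (s : AuctionState) (i : ℕ) : Prop := s.owner (s.target i) = i + 1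

/-- The row `i` bids for the column `j`. -/
def bid (s : AuctionState) (i j : ℕ) : AuctionState where
  owner := Function.update s.owner j (i + 1)
  target := Function.update s.target i j
  price := Function.update s.price j (s.price j + 1)

/-- The total number of bids for the first `n` columns. -/
def totalPrice (s : AuctionState) (n : ℕ) : ℕ := ∑ j ∈ Finset.range n, s.price j

/-- The row `i` need not bid any more: it owns a column, or all its neighbours have reached the
price limit `n + 2`. -/
def Settled (n : ℕ) (E : ℕ → ℕ → Prop) (s : AuctionState) (i : ℕ) : Prop :=
  s.Owns i ∨ ∀ j < n, E i j → n + 2 ≤ s.price j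

/-- The invariant of the auction on the bipartite graph with `n` rows, `n` columns and edges `E`.
By `slack`, a row owns one of its cheapest neighbours, up to one unit of the price. -/
structure Valid (n : ℕ) (E : ℕ → ℕ → Prop) (s : AuctionState) : Prop where
  target_lt : ∀ i < n, s.target i < n
  owner_spec : ∀ j < n, ∀ i, s.owner j = i + 1 → i < n ∧ s.target i = j ∧ E i j
  owner_ne_zero : ∀ j < n, s.price j ≠ 0 → s.owner j ≠ 0
  slack : ∀ j < n, ∀ i, s.owner j = i + 1 → ∀ j' < n, E i j' → s.price j ≤ s.price j' + 1
  price_le : ∀ j < n, s.price j ≤ n + 2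

variable {n : ℕ} {E : ℕ → ℕ → Prop} {s : AuctionState}

theorem Valid.bid (h : s.Valid n E) {i j l : ℕ} (hi : i < n) (hj : j < n) (hE : E i j)
    (hown : ¬ s.Owns i) (hl : l < n + 2) (hjl : s.price j ≤ l)
    (hmin : ∀ j' < n, E i j' → l ≤ s.price j') : (s.bid i j).Valid n E := by
  have hne : ∀ j' < n, s.owner j' ≠ i + 1 := fun j' hj' h' => by
    have h2 := (h.owner_spec j' hj' i h').2.1
    exact hown (by rw [Owns, h2, h'])
  have hmono : ∀ j', s.price j' ≤ (s.bid i j).price j' := fun j' => by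
    by_cases hjj : j' = j
    · subst hjj; simp [AuctionState.bid]
    · simp [AuctionState.bid, hjj]
  refine ⟨fun i' hi' => ?_, fun j' hj' i' h' => ?_, fun j' hj' h' => ?_,
    fun j' hj' i' h' j'' hj'' hE'' => ?_, fun j' hj' => ?_⟩
  · by_cases hii : i' = i
    · subst hii; simpa [AuctionState.bid] using hj
    · simpa [AuctionState.bid, hii] using h.target_lt i' hi'
  · by_cases hjj : j' = j
    · subst hjj
      obtain rfl : i = i' := by simpa [AuctionState.bid] using h'
      exact ⟨hi, by simp [AuctionState.bid], hE⟩
    · have h'' : s.owner j' = i' + 1 := by simpa [AuctionState.bid, hjj] using h'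
      have hii : i' ≠ i := by
        rintro rfl
        exact hne j' hj' h''
      simpa [AuctionState.bid, hii] using h.owner_spec j' hj' i' h''
  · by_cases hjj : j' = j
    · subst hjj; simp [AuctionState.bid]
    · have := h.owner_ne_zero j' hj' (by simpa [AuctionState.bid, hjj] using h')
      simpa [AuctionState.bid, hjj] using this
  · refine le_trans ?_ (Nat.add_le_add_right (hmono j'') 1)
    by_cases hjj : j' = j
    · subst hjj
      obtain rfl : i = i' := by simpa [AuctionState.bid] using h'
      have := hmin j'' hj'' hE''
      simp only [AuctionState.bid, Function.update_self]
      omega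
    · have h'' : s.owner j' = i' + 1 := by simpa [AuctionState.bid, hjj] using h'
      simpa [AuctionState.bid, hjj] using h.slack j' hj' i' h'' j'' hj'' hE''
  · by_cases hjj : j' = j
    · subst hjj
      simp only [AuctionState.bid, Function.update_self]
      omega
    · simpa [AuctionState.bid, hjj] using h.price_le j' hj'

theorem owns_bid (s : AuctionState) (i j : ℕ) : (s.bid i j).Owns i := by
  simp [Owns, AuctionState.bid]

theorem totalPrice_bid {i j : ℕ} (hj : j < n) :
    (s.bid i j).totalPrice n = s.totalPrice n + 1 := by
  simp only [totalPrice, AuctionState.bid]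
  rw [Finset.sum_update_of_mem (Finset.mem_range.2 hj),
    ← Finset.add_sum_erase _ _ (Finset.mem_range.2 hj), Finset.sdiff_singleton_eq_erase]
  ring

theorem Valid.totalPrice_le (h : s.Valid n E) : s.totalPrice n ≤ n * (n + 2) := by
  refine (Finset.sum_le_card_nsmul _ _ (n + 2) fun j hj => h.price_le j (Finset.mem_range.1 hj)).trans
    ?_
  simp

/-- Some price level `k` between `1` and `n + 1` is not attained, by the pigeonhole principle. -/
theorem exists_gap (n : ℕ) (p : ℕ → ℕ) : ∃ k, 1 ≤ k ∧ k < n + 2 ∧ ∀ j < n, p j ≠ k := by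
  by_contra! hcon
  have hsub : Finset.Icc 1 (n + 1) ⊆ (Finset.range n).image p := fun k hk => by
    obtain ⟨h1, h2⟩ := Finset.mem_Icc.1 hk
    obtain ⟨j, hj, hjk⟩ := hcon k h1 (by omega)
    exact Finset.mem_image.2 ⟨j, Finset.mem_range.2 hj, hjk⟩
  have := (Finset.card_le_card hsub).trans Finset.card_image_le
  simp at this

open Classical in
/-- When all rows are settled, the owned columns are those of a maximum matching. At a price level
`k` that is not attained, an edge of any matching leads to a column that is dearer than `k`, hence
owned, or else its row owns a column cheaper than `k`; so the edges of the matching can be sent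
injectively to owned columns. -/
theorem Valid.matchingNumber_eq {A : Pattern n n} (h : s.Valid n E)
    (hE : ∀ i j : Fin n, E i j ↔ A i j = true) (hs : ∀ i < n, s.Settled n E i) :
    matchingNumber A.edges = ((Finset.range n).filter fun j => s.owner j ≠ 0).card := by
  refine le_antisymm ?_ ?_
  · obtain ⟨N, hN, hc⟩ := exists_isMatching_card_eq A.edges
    rw [← hc]
    obtain ⟨k, hk1, hk2, hk⟩ := exists_gap n s.price
    have hrow : ∀ e ∈ N, s.price e.1 < k →
        s.Owns e.2 ∧ s.price (s.target e.2) < k := fun e he hek => by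
      have hEe : E e.2 e.1 := (hE _ _).2 (Finset.mem_filter.1 (hN.1 he)).2
      have hown : s.Owns e.2 := (hs e.2 e.2.2).resolve_right fun h' => by
        have := h' e.1 e.1.2 hEe
        omega
      have hlt := h.target_lt e.2 e.2.2
      have := h.slack _ hlt _ hown e.1 e.1.2 hEe
      have := hk _ hlt
      exact ⟨hown, by omega⟩
    refine Finset.card_le_card_of_injOn
      (fun e => if s.price e.1 < k then s.target e.2 else e.1) (fun e he => ?_)
      fun e he f hf hef => ?_
    · refine Finset.mem_coe.2 (Finset.mem_filter.2 ?_)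
      by_cases hek : s.price e.1 < k
      · have hown := (hrow e he hek).1
        simp only [hek, if_true, Finset.mem_range]
        exact ⟨h.target_lt _ e.2.2, by rw [hown]; omega⟩
      · simp only [hek, if_false, Finset.mem_range]
        exact ⟨e.1.2, h.owner_ne_zero _ e.1.2 (by omega)⟩
    · dsimp only at hef
      split_ifs at hef with h1 h2 h2
      · have e1 := (hrow e he h1).1
        have e2 := (hrow f hf h2).1
        rw [Owns, hef, e2] at e1
        exact hN.snd_injOn he hf (Fin.ext (by omega))
      · have := (hrow e he h1).2
        rw [hef] at this
        exact absurd this h2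
      · have := (hrow f hf h2).2
        rw [← hef] at this
        exact absurd this h1
      · exact hN.fst_injOn he hf (Fin.ext hef)
  · let N : Finset (Fin n × Fin n) := Finset.univ.filter fun e => s.owner e.1 = e.2 + 1
    have hN : IsMatching A.edges N := by
      refine ⟨fun e he => ?_, fun e he f hf hne => ?_⟩
      · have he := (Finset.mem_filter.1 he).2
        exact Finset.mem_filter.2 ⟨Finset.mem_univ _,
          (hE _ _).1 (h.owner_spec _ e.1.2 _ he).2.2⟩
      · have he := (Finset.mem_filter.1 he).2
        have hf := (Finset.mem_filter.1 hf).2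
        refine ⟨fun h1 => hne (Prod.ext h1 (Fin.ext ?_)), fun h2 => hne (Prod.ext (Fin.ext ?_) h2)⟩
        · rw [h1] at he
          omega
        · rw [← (h.owner_spec _ e.1.2 _ he).2.1, ← (h.owner_spec _ f.1.2 _ hf).2.1, h2]
    refine le_trans ?_ hN.card_le_matchingNumber
    refine (Finset.card_le_card fun j hj => ?_).trans
      (Finset.card_image_le (s := N) (f := fun e => (e.1 : ℕ)))
    obtain ⟨hj, h0⟩ := Finset.mem_filter.1 hj
    have hj := Finset.mem_range.1 hj
    obtain ⟨i, hi⟩ := Nat.exists_eq_succ_of_ne_zero h0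
    exact Finset.mem_image.2 ⟨(⟨j, hj⟩, ⟨i, (h.owner_spec j hj i hi).1⟩),
      Finset.mem_filter.2 ⟨Finset.mem_univ _, hi⟩, rfl⟩

/-- After some sweeps over the rows, of which the last one has reached the row `i`, either all rows
are settled, or there have been at least `K + 1` bids, or there have been at least `K`
bids and the rows before `i` are settled. -/
def Progress (n : ℕ) (E : ℕ → ℕ → Prop) (K i : ℕ) (s : AuctionState) : Prop :=
  (∀ i' < n, s.Settled n E i') ∨ K + 1 ≤ s.totalPrice n ∨
    (K ≤ s.totalPrice n ∧ ∀ i' < i, s.Settled n E i')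

/-- The row `i` owns a column, or all its neighbours have at least the price `l`, and those before
`j` even more. -/
def Searched (n : ℕ) (E : ℕ → ℕ → Prop) (i l j : ℕ) (s : AuctionState) : Prop :=
  s.Owns i ∨ ∀ j' < n, E i j' → l ≤ s.price j' ∧ (j' < j → l < s.price j')

theorem Progress.bid {K i j l : ℕ} (h : s.Progress n E K i) (hi : i < n) (hj : j < n) (hE : E i j)
    (hown : ¬ s.Owns i) (hl : l < n + 2) (hjl : s.price j ≤ l) :
    (s.bid i j).Progress n E K i := by
  refine .inr (.inl ?_)
  rw [totalPrice_bid hj]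
  rcases h with h | h | h
  · have := (h i hi).resolve_left hown j hj hE
    omega
  · omega
  · omega

theorem Progress.next_row {K i : ℕ} (h : s.Progress n E K i) (hs : s.Searched n E i (n + 2) 0) :
    s.Progress n E K (i + 1) := by
  refine h.imp_right (Or.imp_right fun h => ⟨h.1, fun i' hi' => ?_⟩)
  rcases Nat.lt_succ_iff_lt_or_eq.1 hi' with h' | rfl
  · exact h.2 i' h'
  · exact hs.imp_right fun h j hj hE => (h j hj hE).1

theorem Progress.next_sweep {K : ℕ} (h : s.Progress n E K n) : s.Progress n E (K + 1) 0 := by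
  rcases h with h | h | h
  · exact .inl h
  · exact .inr (.inr ⟨h, by simp⟩)
  · exact .inl h.2

end AuctionState

end Auction

/-! ### Total correctness of programs with a time bound -/

/-- Started on a memory with `Pre`, the program `P` halts after at most `T` steps on a memory with
`Post`. -/
def Triple (Pre : Store → Prop) (P : Program) (Post : Store → Prop) (T : ℕ) : Prop :=
  ∀ σ, Pre σ → ∃ τ t, Runs P σ τ t ∧ t ≤ T ∧ Post τ

namespace Triple

variable {Pre Mid Post : Store → Prop} {P Q : Program} {S T : ℕ}

theorem skip (h : ∀ σ, Pre σ → Post σ) : Triple Pre .skip Post 1 :=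
  fun σ hσ => ⟨σ, 1, .skip σ, le_rfl, h σ hσ⟩

theorem assign {a : ℕ} {e f v : Expr} :
    Triple (fun σ => Post (σ.write a (e.eval σ) (f.eval σ) (v.eval σ))) (.assign a e f v) Post
      (e.cost + f.cost + v.cost + 1) :=
  fun σ hσ => ⟨_, _, .assign a e f v σ, le_rfl, hσ⟩

theorem seq (hP : Triple Pre P Mid S) (hQ : Triple Mid Q Post T) :
    Triple Pre (.seq P Q) Post (S + T) := fun σ hσ => by
  obtain ⟨τ, s, hs, hsS, hτ⟩ := hP σ hσ
  obtain ⟨ρ, t, ht, htT, hρ⟩ := hQ τ hτ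
  exact ⟨ρ, s + t, hs.seq ht, by omega, hρ⟩

theorem branch {c : Expr} (hP : Triple (fun σ => Pre σ ∧ c.eval σ ≠ 0) P Post S)
    (hQ : Triple (fun σ => Pre σ ∧ c.eval σ = 0) Q Post T) :
    Triple Pre (.branch c P Q) Post (c.cost + (S + T) + 1) := fun σ hσ => by
  by_cases hc : c.eval σ = 0
  · obtain ⟨τ, t, ht, htT, hτ⟩ := hQ σ ⟨hσ, hc⟩
    exact ⟨τ, _, .branch_false hc ht, by omega, hτ⟩
  · obtain ⟨τ, t, ht, htT, hτ⟩ := hP σ ⟨hσ, hc⟩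
    exact ⟨τ, _, .branch_true hc ht, by omega, hτ⟩

theorem weaken {Pre' Post' : Store → Prop} (h : Triple Pre P Post T)
    (hpre : ∀ σ, Pre' σ → Pre σ) (hpost : ∀ σ, Post σ → Post' σ) : Triple Pre' P Post' T :=
  fun σ hσ => by
    obtain ⟨τ, t, ht, htT, hτ⟩ := h σ (hpre σ hσ)
    exact ⟨τ, t, ht, htT, hpost τ hτ⟩

theorem mono_time (h : Triple Pre P Post S) (hST : S ≤ T) : Triple Pre P Post T := fun σ hσ => by
  obtain ⟨τ, t, ht, htS, hτ⟩ := h σ hσ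
  exact ⟨τ, t, ht, htS.trans hST, hτ⟩

end Triple

/-- The program `P` contains an assignment to the array `a`. -/
def Program.writes (a : ℕ) : Program → Bool
  | .skip => false
  | .assign b _ _ _ => a == b
  | .seq P Q => P.writes a || Q.writes a
  | .branch _ P Q => P.writes a || Q.writes a
  | .loop _ P => P.writes a

theorem Runs.array_eq {P : Program} {σ τ : Store} {t a : ℕ} (h : Runs P σ τ t)
    (ha : P.writes a = false) : τ a = σ a := by
  induction h with
  | skip => rfl
  | assign b e f v σ =>
    funext i j
    have : a ≠ b := by simpa [Program.writes] using ha
    simp [Store.write, this]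
  | seq _ _ ih₁ ih₂ =>
    rw [Program.writes, Bool.or_eq_false_iff] at ha
    rw [ih₂ ha.2, ih₁ ha.1]
  | branch_true _ _ ih =>
    rw [Program.writes, Bool.or_eq_false_iff] at ha
    exact ih ha.1
  | branch_false _ _ ih =>
    rw [Program.writes, Bool.or_eq_false_iff] at ha
    exact ih ha.2
  | loop_done => rfl
  | loop_step _ _ _ ih₁ ih₂ => rw [ih₂ ha, ih₁ ha]

/-- The frame rule: a property of an array to which the program does not write is preserved. -/
theorem Triple.frame {Pre Post : Store → Prop} {P : Program} {T a : ℕ} (h : Triple Pre P Post T)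
    (ha : P.writes a = false) (R : (ℕ → ℕ → ℕ) → Prop) :
    Triple (fun σ => Pre σ ∧ R (σ a)) P (fun σ => Post σ ∧ R (σ a)) T := fun σ hσ => by
  obtain ⟨τ, t, ht, htT, hτ⟩ := h σ hσ.1
  exact ⟨τ, t, ht, htT, hτ, (ht.array_eq ha).symm ▸ hσ.2⟩

/-- The scalar variable held in the cell `(0, 0)` of the array `a`. -/
def Expr.var (a : ℕ) : Expr := .cell a (.lit 0) (.lit 0)

@[simp] theorem Expr.eval_var (a : ℕ) (σ : Store) : (Expr.var a).eval σ = σ a 0 0 := rfl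

/-- `for a = 0, …, N - 1 do P`, with the counter in the scalar variable `a`. -/
def Program.forLoop (a : ℕ) (N : Expr) (P : Program) : Program :=
  .seq (.assign a (.lit 0) (.lit 0) (.lit 0))
    (.loop (.lt (.var a) N)
      (.seq P (.assign a (.lit 0) (.lit 0) (.add (.var a) (.lit 1)))))

/-- A bound for the time of a `for` loop with `b` rounds of time `T`, if the evaluation of the
limit takes the time `c`. It is used both for numbers and for polynomials. -/
def loopBound {R : Type*} [CommSemiring R] (c : ℕ) (b T : R) : R :=
  b * (T + ((c + 13 : ℕ) : R)) + ((c + 9 : ℕ) : R)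

/-- The rule for a `for` loop. The invariant `I k` holds whenever the counter is `k`, and is not
affected by the value of the counter cell itself; the body does not write to the counter. -/
theorem Triple.forLoop {a : ℕ} {N : Expr} {P : Program} {I : ℕ → Store → Prop} {b T : ℕ}
    (hI : ∀ k σ v, I k σ → I k (σ.write a 0 0 v)) (hb : ∀ k σ, I k σ → N.eval σ = b)
    (ha : P.writes a = false)
    (hP : ∀ k < b, Triple (fun σ => I k σ ∧ σ a 0 0 = k) P (I (k + 1)) T) :
    Triple (I 0) (.forLoop a N P) (I b) (loopBound N.cost b T) := by
  have key : ∀ d k σ, k + d = b → I k σ → σ a 0 0 = k → ∃ τ t,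
      Runs (.loop (.lt (.var a) N)
        (.seq P (.assign a (.lit 0) (.lit 0) (.add (.var a) (.lit 1))))) σ τ t ∧
      t ≤ d * (T + (N.cost + 13)) + (N.cost + 5) ∧ I b τ := by
    intro d
    induction d with
    | zero =>
      intro k σ hk hσ hc
      refine ⟨σ, _, .loop_done ?_, ?_, ?_⟩
      · simp only [Expr.eval, Expr.eval_var, hb k σ hσ, hc]
        exact if_neg (by omega)
      · simp only [Expr.cost, Expr.var]
        omega
      · rwa [show b = k by omega]
    | succ d ih =>
      intro k σ hk hσ hc
      obtain ⟨τ, s, hs, hsT, hτ⟩ := hP k (by omega) σ ⟨hσ, hc⟩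
      have hτc : τ a 0 0 = k := by rw [hs.array_eq ha, hc]
      obtain ⟨ρ, t, ht, htT, hρ⟩ := ih (k + 1) (τ.write a 0 0 (k + 1)) (by omega)
        (hI _ _ _ hτ) (by simp [Store.write])
      have hassign := Runs.assign a (.lit 0) (.lit 0) (.add (.var a) (.lit 1)) τ
      simp only [Expr.eval, Expr.eval_var, hτc] at hassign
      refine ⟨ρ, _, .loop_step ?_ (hs.seq hassign) ht, ?_, hρ⟩
      · simp only [Expr.eval, Expr.eval_var, hb k σ hσ, hc]
        rw [if_pos (by omega)]
        exact one_ne_zero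
      · simp only [Expr.cost, Expr.var]
        rw [Nat.succ_mul]
        omega
  intro σ hσ
  obtain ⟨τ, t, ht, htT, hτ⟩ := key b 0 (σ.write a 0 0 0) (by omega) (hI _ _ _ hσ)
    (by simp [Store.write])
  refine ⟨τ, _, (Runs.assign a (.lit 0) (.lit 0) (.lit 0) σ).seq ht, ?_, hτ⟩
  simp only [Expr.cost, loopBound, Nat.cast_id]
  omega

theorem eval_loopBound (c : ℕ) (b T : Polynomial ℕ) (n : ℕ) :
    (loopBound c b T).eval n = loopBound c (b.eval n) (T.eval n) := by
  simp [loopBound]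

/-! ### The auction as a program -/

section Machine

open AuctionState

theorem Store.write_of_ne {σ : Store} {a a' : ℕ} (h : a' ≠ a) (i j v : ℕ) :
    σ.write a i j v a' = σ a' := by
  funext i' j'
  simp [Store.write, h]

theorem Store.write_self (σ : Store) (a i j v : ℕ) : σ.write a i j v a i j = v := by
  simp [Store.write]

/-- The state of the auction in a memory: the arrays `5`, `6`, `7` hold the targets of the rows,
and the owners and prices of the columns. -/
def Store.auction (σ : Store) : AuctionState where
  owner j := σ 6 j 0
  target i := σ 5 i 0
  price j := σ 7 j 0

theorem Store.auction_write {a : ℕ} (h5 : 5 ≠ a) (h6 : 6 ≠ a) (h7 : 7 ≠ a) (σ : Store)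
    (i j v : ℕ) : (σ.write a i j v).auction = σ.auction := by
  simp only [Store.auction, Store.write_of_ne h5, Store.write_of_ne h6, Store.write_of_ne h7]

/-- The memory holds the input and a state of the auction with the property `p`. -/
def Holds {n : ℕ} (A : Pattern n n) (p : AuctionState → Prop) (σ : Store) : Prop :=
  σ 0 0 0 = n ∧ σ 2 = A.toArray ∧ p σ.auction

/-- The edges of the bipartite graph of a pattern, as a relation between row and column numbers. -/
def Pattern.Adj {n m : ℕ} (P : Pattern n m) (i j : ℕ) : Prop := P.toArray i j ≠ 0

theorem Pattern.adj_iff {n m : ℕ} (P : Pattern n m) (i : Fin n) (j : Fin m) :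
    P.Adj i j ↔ P i j = true := by
  simp [Pattern.Adj, Pattern.toArray]

/-- The arrays from `8` on are free for loop counters, and `3` and `4` for the output. -/
theorem Holds.write {n : ℕ} {A : Pattern n n} {p : AuctionState → Prop} {σ : Store}
    (h : Holds A p σ) {a : ℕ} (ha : 7 < a ∨ a = 3 ∨ a = 4) (i j v : ℕ) :
    Holds A p (σ.write a i j v) := by
  unfold Holds
  rw [Store.write_of_ne (by omega), Store.write_of_ne (by omega),
    Store.auction_write (by omega) (by omega) (by omega)]
  exact h

theorem Holds.imp {n : ℕ} {A : Pattern n n} {p q : AuctionState → Prop} {σ : Store}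
    (h : Holds A p σ) (hpq : ∀ s, p s → q s) : Holds A q σ :=
  ⟨h.1, h.2.1, hpq _ h.2.2⟩

/-- The row in the scalar variable `12` bids for the column in the scalar variable `14`. -/
def bidProgram : Program :=
  .seq (.assign 6 (.var 14) (.lit 0) (.add (.var 12) (.lit 1)))
    (.seq (.assign 5 (.var 12) (.lit 0) (.var 14))
      (.assign 7 (.var 14) (.lit 0) (.add (.cell 7 (.var 14) (.lit 0)) (.lit 1))))

/-- The row in the scalar variable `12` bids for the column in the scalar variable `14` if it owns
no column, the two are joined by an edge, and the price is at most the scalar variable `13`. As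
subtraction is truncated, `(x - y) + (y - x)` is nonzero if and only if `x ≠ y`. -/
def tryBidProgram : Program :=
  .branch (.add (.sub (.cell 6 (.cell 5 (.var 12) (.lit 0)) (.lit 0)) (.add (.var 12) (.lit 1)))
      (.sub (.add (.var 12) (.lit 1)) (.cell 6 (.cell 5 (.var 12) (.lit 0)) (.lit 0))))
    (.branch (.cell 2 (.var 12) (.var 14))
      (.branch (.lt (.cell 7 (.var 14) (.lit 0)) (.add (.var 13) (.lit 1))) bidProgram .skip)
      .skip)
    .skip

theorem triple_bidProgram (Post : Store → Prop) :
    Triple (fun σ => Post (((σ.write 6 (σ 14 0 0) 0 (σ 12 0 0 + 1)).write 5 (σ 12 0 0) 0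
      (σ 14 0 0)).write 7 (σ 14 0 0) 0 (σ 7 (σ 14 0 0) 0 + 1))) bidProgram Post 30 :=
  Triple.mono_time (Triple.weaken (.seq .assign (.seq .assign .assign)) (fun _ h => h)
    fun _ h => h) (by decide)

theorem Store.auction_bid (σ : Store) (i j : ℕ) :
    (((σ.write 6 j 0 (i + 1)).write 5 i 0 j).write 7 j 0 (σ 7 j 0 + 1)).auction =
      σ.auction.bid i j := by
  simp [Store.auction, AuctionState.bid, Store.write, Function.update_apply, funext_iff]


/-- Two loops for the row in the scalar variable `12`: the columns are scanned for a price at most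
`0, 1, …, n + 1` in turn, so that a bid goes to a cheapest neighbour. -/
def searchProgram : Program :=
  .forLoop 13 (.add (.var 0) (.lit 2)) (.forLoop 14 (.var 0) tryBidProgram)

/-- The state of the auction in the course of a sweep. -/
def SweepState {n : ℕ} (A : Pattern n n) (K i : ℕ) (σ : Store) : Prop :=
  Holds A (fun s => s.Valid n A.Adj ∧ s.Progress n A.Adj K i) σ

/-- The state of the auction in the course of the search for a bid of the row `i`. -/
def SearchState {n : ℕ} (A : Pattern n n) (K i l j : ℕ) (σ : Store) : Prop :=
  Holds A (fun s => s.Valid n A.Adj ∧ s.Progress n A.Adj K i ∧ s.Searched n A.Adj i l j) σ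

variable {n : ℕ} {A : Pattern n n}

theorem triple_tryBidProgram {K i l j : ℕ} (hi : i < n) (hl : l < n + 2) (hj : j < n) :
    Triple (fun σ => ((SearchState A K i l j σ ∧ σ 12 0 0 = i) ∧ σ 13 0 0 = l) ∧ σ 14 0 0 = j)
      tryBidProgram (SearchState A K i l (j + 1)) 100 := by
  have hskip : ∀ σ : Store, SearchState A K i l j σ →
      (A.Adj i j → ¬ σ.auction.Owns i → l < σ.auction.price j) →
      SearchState A K i l (j + 1) σ := by
    rintro σ h hno
    refine ⟨h.1, h.2.1, h.2.2.1, h.2.2.2.1, ?_⟩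
    by_cases hown : σ.auction.Owns i
    · exact .inl hown
    · refine .inr fun j' hj' hE => ?_
      obtain ⟨h1, h2⟩ := h.2.2.2.2.resolve_left hown j' hj' hE
      refine ⟨h1, fun hlt => ?_⟩
      rcases Nat.lt_succ_iff_lt_or_eq.1 hlt with h' | rfl
      · exact h2 h'
      · exact hno hE hown
  refine ((Triple.branch (.branch (.branch ((triple_bidProgram _).weaken ?_ fun σ h => h)
    (.skip ?_)) (.skip ?_)) (.skip ?_)).mono_time (by decide))
  · rintro σ ⟨⟨⟨⟨⟨⟨h, h12⟩, h13⟩, h14⟩, hown⟩, hE⟩, hlt⟩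
    simp only [Expr.eval, Expr.eval_var, h12, h13, h14] at hown hE hlt
    have hown : ¬ σ.auction.Owns i := by
      intro h'
      have h' : σ 6 (σ 5 i 0) 0 = i + 1 := h'
      omega
    have hE : A.Adj i j := by
      rw [h.2.1] at hE
      exact hE
    have hlt : σ.auction.price j ≤ l := by
      by_contra hcon
      exact hlt (if_neg fun h' => hcon (Nat.lt_succ_iff.1 h'))
    rw [h12, h14]
    refine ⟨?_, ?_, ?_⟩
    · simpa [Store.write] using h.1
    · rw [Store.write_of_ne (by decide), Store.write_of_ne (by decide),
        Store.write_of_ne (by decide), h.2.1]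
    · rw [Store.auction_bid]
      exact ⟨h.2.2.1.bid hi hj hE hown hl hlt
          fun j' hj' hE' => (h.2.2.2.2.resolve_left hown j' hj' hE').1,
        h.2.2.2.1.bid hi hj hE hown hl hlt, .inl (owns_bid _ _ _)⟩
  · rintro σ ⟨⟨⟨⟨⟨⟨h, h12⟩, h13⟩, h14⟩, -⟩, -⟩, hlt⟩
    refine hskip σ h fun _ _ => ?_
    simp only [Expr.eval, Expr.eval_var, h13, h14] at hlt
    by_contra hcon
    exact one_ne_zero ((if_pos (Nat.lt_succ_of_le (not_lt.1 hcon))).symm.trans hlt)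
  · rintro σ ⟨⟨⟨⟨⟨h, h12⟩, h13⟩, h14⟩, -⟩, hE⟩
    refine hskip σ h fun hE' _ => absurd ?_ hE'
    simpa only [Expr.eval, Expr.eval_var, h12, h14, h.2.1] using hE
  · rintro σ ⟨⟨⟨⟨h, h12⟩, h13⟩, h14⟩, hown⟩
    refine hskip σ h fun _ hown' => absurd ?_ hown'
    simp only [Expr.eval, Expr.eval_var, h12] at hown
    change σ 6 (σ 5 i 0) 0 = i + 1
    omega

theorem triple_searchProgram {K i : ℕ} (hi : i < n) :
    Triple (fun σ => SweepState A K i σ ∧ σ 12 0 0 = i) searchProgram (SweepState A K (i + 1))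
      (loopBound 5 (n + 2) (loopBound 3 n 100)) := by
  refine (Triple.forLoop (I := fun l σ => SearchState A K i l 0 σ ∧ σ 12 0 0 = i) (b := n + 2)
    (fun l σ v h => ⟨h.1.write (.inl (by decide)) _ _ _, by simpa [Store.write] using h.2⟩)
    (fun l σ h => by simp [Expr.eval, h.1.1]) rfl fun l hl => ?_).weaken ?_ ?_
  · refine (Triple.forLoop (N := .var 0)
      (I := fun j σ => (SearchState A K i l j σ ∧ σ 12 0 0 = i) ∧ σ 13 0 0 = l) (b := n)
      (fun j σ v h => ⟨⟨h.1.1.write (.inl (by decide)) _ _ _, by simpa [Store.write] using h.1.2⟩,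
        by simpa [Store.write] using h.2⟩)
      (fun j σ h => h.1.1.1) rfl fun j hj => ?_).weaken (fun σ h => h) ?_
    · exact (((triple_tryBidProgram hi hl hj).frame (a := 12) rfl fun c => c 0 0 = i).frame
        (a := 13) rfl fun c => c 0 0 = l).weaken
        (fun σ h => ⟨⟨h, h.1.1.2⟩, h.1.2⟩) fun σ h => h
    · rintro σ ⟨⟨h, h12⟩, -⟩
      refine ⟨h.imp fun s hs => ⟨hs.1, hs.2.1, hs.2.2.imp_right fun h' j hj hE => ?_⟩, h12⟩
      exact ⟨(h' j hj hE).2 hj, by simp⟩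
  · rintro σ ⟨h, h12⟩
    exact ⟨h.imp fun s hs => ⟨hs.1, hs.2, .inr fun j _ _ => by simp⟩, h12⟩
  · rintro σ ⟨h, -⟩
    exact h.imp fun s hs => ⟨hs.1, hs.2.1.next_row hs.2.2⟩

/-- The auction: `n (n + 3)` sweeps over the rows, counted by two nested loops, as the machine has no
multiplication. The price limits allow `n (n + 2)` bids only. -/
def auctionProgram : Program :=
  .forLoop 10 (.var 0) (.forLoop 11 (.add (.var 0) (.lit 3)) (.forLoop 12 (.var 0) searchProgram))

/-- A bound for the time of `auctionProgram`, as a number or as a polynomial. -/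
def auctionBound {R : Type*} [CommSemiring R] (n : R) : R :=
  loopBound 3 n (loopBound 5 (n + 3) (loopBound 3 n
    (loopBound 5 (n + 2) (loopBound 3 n 100))))

theorem triple_auctionProgram :
    Triple (Holds A fun s => s.Valid n A.Adj) auctionProgram
      (Holds A fun s => s.Valid n A.Adj ∧ ∀ i < n, s.Settled n A.Adj i) (auctionBound n) := by
  refine (Triple.forLoop (N := .var 0) (I := fun q => SweepState A (q * (n + 3)) 0) (b := n)
    (fun q σ v h => h.write (.inl (by decide)) _ _ _)
    (fun q σ h => h.1) rfl fun q _ => ?_).weaken ?_ ?_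
  · refine (Triple.forLoop (I := fun r => SweepState A (q * (n + 3) + r) 0) (b := n + 3)
      (fun r σ v h => h.write (.inl (by decide)) _ _ _)
      (fun r σ h => by simp [Expr.eval, h.1]) rfl fun r _ => ?_).weaken (fun σ h => h.1) ?_
    · exact (Triple.forLoop (N := .var 0) (I := SweepState A (q * (n + 3) + r)) (b := n)
        (fun i σ v h => h.write (.inl (by decide)) _ _ _) (fun i σ h => h.1) rfl
        fun i hi => triple_searchProgram hi).weaken (fun σ h => h.1)
        fun σ h => h.imp fun s hs => ⟨hs.1, hs.2.next_sweep⟩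
    · intro σ h
      rwa [← Nat.succ_mul] at h
  · intro σ h
    exact h.imp fun s hs => ⟨hs, .inr (.inr ⟨by simp, by simp⟩)⟩
  · intro σ h
    refine h.imp fun s hs => ⟨hs.1, ?_⟩
    rcases n.eq_zero_or_pos with rfl | hn
    · simp
    -- So many bids would exceed the price limit, so all rows are settled.
    · have := hs.1.totalPrice_le
      have : n * (n + 2) < n * (n + 3) := Nat.mul_lt_mul_of_pos_left (by omega) hn
      rcases hs.2 with h' | h' | h'
      · exact h'
      · omega
      · omega

/-- The scalar variable `3` becomes the number of columns without an owner, or `1` if there is no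
such column. -/
def countProgram : Program :=
  .seq (.forLoop 14 (.var 0) (.branch (.cell 6 (.var 14) (.lit 0)) .skip
      (.assign 3 (.lit 0) (.lit 0) (.add (.var 3) (.lit 1)))))
    (.branch (.var 3) .skip (.assign 3 (.lit 0) (.lit 0) (.lit 1)))

theorem triple_countProgram :
    Triple (fun σ => Holds A (fun s => s.Valid n A.Adj ∧ ∀ i < n, s.Settled n A.Adj i) σ ∧
        σ 3 0 0 = 0) countProgram
      (fun σ => σ 0 0 0 = n ∧ σ 3 0 0 = max (n - matchingNumber A.edges) 1)
      (loopBound 3 n 40 + 20) := by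
  let I : ℕ → Store → Prop := fun j σ =>
    Holds A (fun s => s.Valid n A.Adj ∧ ∀ i < n, s.Settled n A.Adj i) σ ∧
      σ 3 0 0 = ((Finset.range j).filter fun j' => σ.auction.owner j' = 0).card
  refine Triple.seq (Mid := I n) ((Triple.forLoop (N := .var 0) (I := I) (b := n) ?_
    (fun j σ h => h.1.1) rfl fun j hj => ?_).weaken ?_ fun σ h => h) ?_
  · rintro j σ v ⟨h, h3⟩
    refine ⟨h.write (.inl (by decide)) _ _ _, ?_⟩
    rw [Store.auction_write (by decide) (by decide) (by decide), ← h3]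
    simp [Store.write]
  · refine (Triple.branch (.skip ?_) (Triple.assign.weaken ?_ fun σ h => h)).mono_time (by decide)
    · rintro σ ⟨⟨⟨h, h3⟩, h14⟩, hc⟩
      refine ⟨h, ?_⟩
      simp only [Expr.eval, Expr.eval_var, h14] at hc
      have hc : ¬ σ.auction.owner j = 0 := hc
      rw [Finset.range_add_one, Finset.filter_insert, if_neg hc, h3]
    · rintro σ ⟨⟨⟨h, h3⟩, h14⟩, hc⟩
      simp only [Expr.eval, Expr.eval_var, h14] at hc ⊢
      have hc : σ.auction.owner j = 0 := hc
      refine ⟨h.write (.inr (.inl rfl)) _ _ _, ?_⟩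
      rw [Store.auction_write (by decide) (by decide) (by decide), Store.write_self,
        Finset.range_add_one, Finset.filter_insert, if_pos hc, Finset.card_insert_of_notMem (by simp),
        h3]
  · rintro σ ⟨h, h3⟩
    exact ⟨h, by simpa using h3⟩
  · have hcount : ∀ σ, I n σ → σ 3 0 0 = n - matchingNumber A.edges := by
      rintro σ ⟨h, h3⟩
      rw [h3, h.2.2.1.matchingNumber_eq (fun i j => A.adj_iff i j) h.2.2.2]
      have := Finset.card_filter_add_card_filter_not (s := Finset.range n)
        (fun j => σ.auction.owner j = 0)
      rw [Finset.card_range] at this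
      exact (Nat.sub_eq_of_eq_add this.symm).symm
    refine (Triple.branch (.skip ?_) (Triple.assign.weaken ?_ fun σ h => h)).mono_time (by decide)
    · rintro σ ⟨h, hc⟩
      rw [Expr.eval_var] at hc
      have := hcount σ h
      exact ⟨h.1.1, by omega⟩
    · rintro σ ⟨h, hc⟩
      rw [Expr.eval_var] at hc
      have := hcount σ h
      simp only [Expr.eval]
      exact ⟨by simpa [Store.write] using h.1.1, by rw [Store.write_self]; omega⟩

/-- The cells `(i, j)` of the array `4` with `i, j < n` become `1`. -/
def fillProgram : Program :=
  .forLoop 12 (.var 0) (.forLoop 14 (.var 0) (.assign 4 (.var 12) (.var 14) (.lit 1)))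

theorem triple_fillProgram :
    Triple (fun σ => σ 0 0 0 = n) fillProgram (fun σ => ∀ i < n, ∀ j < n, σ 4 i j ≠ 0)
      (loopBound 3 n (loopBound 3 n 8)) := by
  have hw : ∀ (σ : Store) (i j : ℕ), ∀ i' j', σ 4 i' j' ≠ 0 → σ.write 4 i j 1 4 i' j' ≠ 0 := by
    intro σ i j i' j' h
    unfold Store.write
    split_ifs
    · exact one_ne_zero
    · exact h
  refine (Triple.forLoop (N := .var 0)
    (I := fun i σ => σ 0 0 0 = n ∧ ∀ i' < i, ∀ j < n, σ 4 i' j ≠ 0) (b := n)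
    (fun i σ v h => by simpa [Store.write] using h) (fun i σ h => h.1) rfl fun i _ => ?_).weaken
    (fun σ h => ⟨h, by simp⟩) fun σ h => h.2
  refine (Triple.forLoop (N := .var 0) (I := fun j σ => (σ 0 0 0 = n ∧
      ∀ i' < i, ∀ j < n, σ 4 i' j ≠ 0) ∧ σ 12 0 0 = i ∧ ∀ j' < j, σ 4 i j' ≠ 0) (b := n)
    (fun j σ v h => by simpa [Store.write] using h) (fun j σ h => h.1.1) rfl
    fun j _ => Triple.assign.weaken ?_ fun σ h => h).weaken
    (fun σ h => ⟨h.1, h.2, by simp⟩) ?_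
  · rintro σ ⟨⟨⟨h0, h1⟩, h12, h2⟩, h14⟩
    simp only [Expr.eval, Expr.eval_var, h12, h14]
    refine ⟨⟨by simpa [Store.write] using h0, fun i' hi' j' hj' => hw σ _ _ _ _ (h1 i' hi' j' hj')⟩,
      by simpa [Store.write] using h12, fun j' hj' => ?_⟩
    rcases Nat.lt_succ_iff_lt_or_eq.1 hj' with h' | rfl
    · exact hw σ _ _ _ _ (h2 j' h')
    · rw [Store.write_self]
      exact one_ne_zero
  · rintro σ ⟨⟨h0, h1⟩, -, h2⟩
    refine ⟨h0, fun i' hi' => ?_⟩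
    rcases Nat.lt_succ_iff_lt_or_eq.1 hi' with h' | rfl
    · exact h1 i' h'
    · exact h2

/-- The program that computes the minimum number of inputs and puts out a full input pattern. -/
def minimumInputProgram : Program :=
  .seq auctionProgram (.seq countProgram fillProgram)

/-- A bound for the time of `minimumInputProgram`, as a number or as a polynomial. -/
def minimumInputBound {R : Type*} [CommSemiring R] (n : R) : R :=
  auctionBound n + ((loopBound 3 n 40 + 20) + loopBound 3 n (loopBound 3 n 8))

/-- In the initial memory no column has an owner and all prices are zero. -/
theorem holds_inputStore (F A : Pattern n n) :
    Holds A (fun s => s.Valid n A.Adj) (inputStore F A) := by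
  refine ⟨rfl, rfl, ?_, ?_, ?_, ?_, ?_⟩
  · intro i hi
    change 0 < n
    omega
  · intro j _ i h
    exact absurd h.symm (Nat.succ_ne_zero i)
  · intro j _ h
    exact absurd rfl h
  · intro j _ i h
    exact absurd h.symm (Nat.succ_ne_zero i)
  · intro j _
    exact Nat.zero_le _

theorem triple_minimumInputProgram (F A : Pattern n n) :
    Triple (fun σ => σ = inputStore F A) minimumInputProgram
      (fun σ => (∀ i < n, ∀ j < n, σ 4 i j ≠ 0) ∧
        σ 3 0 0 = max (n - matchingNumber A.edges) 1) (minimumInputBound n) := by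
  refine Triple.seq (((triple_auctionProgram (A := A)).frame (a := 3) rfl fun c => c 0 0 = 0).weaken
    ?_ fun σ h => h) (.seq triple_countProgram (triple_fillProgram.frame (a := 3) rfl
      fun c => c 0 0 = max (n - matchingNumber A.edges) 1))
  rintro σ rfl
  exact ⟨holds_inputStore F A, rfl⟩

theorem eval_minimumInputBound (n : ℕ) :
    (minimumInputBound Polynomial.X : Polynomial ℕ).eval n = minimumInputBound n := by
  simp [minimumInputBound, auctionBound, eval_loopBound]

end Machine

end Descriptor

open Descriptor in
theorem theorem1 :
    (∀ (n : ℕ) (F A : Pattern n n),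
      matchingNumber (A.edges ∪ F.edges) = n →
        IsLeast (feasibleInputCounts F A) (max (n - matchingNumber A.edges) 1)) ∧
    (∃ (P : Program) (p : Polynomial ℕ), ∀ (n : ℕ) (F A : Pattern n n),
      matchingNumber (A.edges ∪ F.edges) = n →
        ∃ (σ : Store) (t : ℕ), Runs P (inputStore F A) σ t ∧ t ≤ p.eval n ∧
          IsLeast (feasibleInputCounts F A) (outputCount σ) ∧
          StructurallyControllable F A (outputPattern n (outputCount σ) σ)) := by
  refine ⟨fun n F A h => isLeast_feasibleInputCounts h, minimumInputProgram,
    minimumInputBound Polynomial.X, fun n F A h => ?_⟩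
  obtain ⟨σ, t, ht, htT, h4, h3⟩ := triple_minimumInputProgram F A _ rfl
  have hcount : outputCount σ = max (n - matchingNumber A.edges) 1 := h3
  refine ⟨σ, t, ht, (eval_minimumInputBound n).symm ▸ htT, ?_, ?_⟩
  · rw [hcount]
    exact isLeast_feasibleInputCounts h
  · have hfull : outputPattern n (outputCount σ) σ = fun _ _ => true := by
      funext i j
      have hi := i.2
      have hj := j.2
      exact decide_eq_true (h4 i hi j (by omega))
    rw [hfull]
    exact structurallyControllable_full h (by omega) (by omega)
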